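/- For a commutative ring $R$ with identity and ideals $I,J$ of $R$, put $I\to J=\{x\in R : xI\subseteq J\}$. The ring $R$ is called an \emph{MTL-ring} if $(I\to J)+(J\to I)=R$ for all ideals $I,J$ of $R$; equivalently, its ideals with the operations $\cap,+,\cdot,\to$ form an MTL-algebra. It is called a \emph{BL-ring} if its ideals with these operations form a BL-algebra, that is, if $R$ is an MTL-ring and moreover $I\cap J=I\cdot(I\to J)$ for all ideals $I,J$ of $R$. \textbf{Theorem.} Let $\mathcal{H}(\mathbb{C})$ be the ring of entire functions (functions holomorphic on the whole complex plane, with pointwise operations). If $M$ is a maximal ideal of $\mathcal{H}(\mathbb{C})$ that is not finitely generated, then the localization $\mathcal{H}(\mathbb{C})_M$ of $\mathcal{H}(\mathbb{C})$ at $M$ is an MTL-ring that is not a BL-ring. -/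

import Mathlib

/-- The ring `H(ℂ)` of entire functions, with pointwise operations. -/
def entireFunctions : Subring (ℂ → ℂ) where
  carrier := {f | Differentiable ℂ f}
  mul_mem' hf hg := Differentiable.mul hf hg
  one_mem' := differentiable_const 1
  add_mem' hf hg := Differentiable.add hf hg
  zero_mem' := differentiable_const 0
  neg_mem' hf := Differentiable.neg hf

/-- The bounded lattice `L`, with its commutative monoid structure and the operation `imp`
as residuum, is an MTL-algebra. -/
structure IsMTLAlgebra (L : Type*) [Lattice L] [BoundedOrder L] [CommMonoid L]
    (imp : L → L → L) : Prop where
  /-- The unit of the monoid is the top of the lattice. -/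
  one_eq_top : (1 : L) = ⊤
  /-- Residuation (adjointness). -/
  mul_le_iff : ∀ x y z : L, x * y ≤ z ↔ x ≤ imp y z
  /-- Prelinearity. -/
  prelinear : ∀ x y : L, imp x y ⊔ imp y x = ⊤

/-- A BL-algebra is an MTL-algebra that satisfies the divisibility condition. -/
structure IsBLAlgebra (L : Type*) [Lattice L] [BoundedOrder L] [CommMonoid L]
    (imp : L → L → L) : Prop extends IsMTLAlgebra L imp where
  /-- Divisibility. -/
  divisible : ∀ x y : L, x ⊓ y = x * imp x y

/-- The residuum `I → J = {x ∈ R : x I ⊆ J}` of two ideals. -/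
def idealImp {R : Type*} [CommRing R] (I J : Ideal R) : Ideal R where
  carrier := {x | ∀ a ∈ I, x * a ∈ J}
  add_mem' {x y} hx hy a ha := by
    rw [add_mul]
    exact J.add_mem (hx a ha) (hy a ha)
  zero_mem' a _ := by
    rw [zero_mul]
    exact J.zero_mem
  smul_mem' c x hx a ha := by
    rw [smul_eq_mul, mul_assoc]
    exact J.mul_mem_left c (hx a ha)

/-- An MTL-ring: `(I → J) + (J → I) = R` for all ideals `I`, `J`. -/
def IsMTLRing (R : Type*) [CommRing R] : Prop :=
  ∀ I J : Ideal R, idealImp I J + idealImp J I = ⊤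

/-- A BL-ring: the ideals, with intersection, sum, product and residuum, form a BL-algebra. -/
def IsBLRing (R : Type*) [CommRing R] : Prop :=
  IsBLAlgebra (Ideal R) idealImp

/-- The ideals of a ring always form a residuated lattice. -/
theorem mul_le_iff_le_idealImp {R : Type*} [CommRing R] (I J K : Ideal R) :
    I * J ≤ K ↔ I ≤ idealImp J K := by
  rw [Ideal.mul_le]
  exact Iff.rfl

/-- A ring is an MTL-ring exactly when its ideals form an MTL-algebra. -/
theorem isMTLRing_iff_isMTLAlgebra (R : Type*) [CommRing R] :
    IsMTLRing R ↔ IsMTLAlgebra (Ideal R) idealImp :=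
  ⟨fun h => ⟨Ideal.one_eq_top, mul_le_iff_le_idealImp, h⟩, fun h => h.prelinear⟩

/-- A ring is a BL-ring exactly when it is an MTL-ring in which divisibility holds. -/
theorem isBLRing_iff (R : Type*) [CommRing R] :
    IsBLRing R ↔ IsMTLRing R ∧ ∀ I J : Ideal R, I ⊓ J = I * idealImp I J :=
  ⟨fun h => ⟨h.prelinear, h.divisible⟩,
    fun h => ⟨(isMTLRing_iff_isMTLAlgebra R).1 h.1, h.2⟩⟩

/-! Two nonzero entire functions have a common divisor with coprime cofactors
(`exists_eq_mul_isCoprime`). At least one cofactor lies outside M and becomes a unit, so the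
localization is a valuation domain; its ideals form a chain, which gives prelinearity. Divisibility
fails because M contains no z - a. Removing from a nonzero member of M its zeros in a disc therefore
leaves a member u_n of M. Suitably corrected tail products of the u_n satisfy q_N = u_N q_{N+1}
(`exists_chain`), and for I = ⋃ (q_n), J = (q_0) divisibility would make some u_n a unit
(`not_isBLRing_of_chain`). The analytic input is the Cousin problem on discs, additive
(`exists_differentiableOn_sub_eq`) and multiplicative (`exists_differentiableOn_mul_eq`). -/

open Metric Set Filter Topology

/-! ### Cousin problems on an exhaustion by discs -/

/-- A function holomorphic on a disc is a uniform limit of entire functions on smaller discs. -/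
theorem exists_differentiable_norm_sub_le {c : ℂ → ℂ} {n : ℕ}
    (hc : DifferentiableOn ℂ c (ball 0 n)) {ε : ℝ} (hε : 0 < ε) :
    ∃ p : ℂ → ℂ, Differentiable ℂ p ∧ ∀ z ∈ ball (0 : ℂ) ((n : ℝ) - 1), ‖c z - p z‖ ≤ ε := by
  rcases Nat.lt_or_ge n 2 with hn | hn
  · refine ⟨fun _ => 0, differentiable_const _, fun z hz => ?_⟩
    have h1 : (n : ℝ) ≤ 1 := by exact_mod_cast Nat.lt_succ_iff.1 hn
    rw [mem_ball_zero_iff] at hz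
    linarith [norm_nonneg z]
  · have hn' : (2 : ℝ) ≤ n := by exact_mod_cast hn
    -- Since r < R < n, the Taylor series converges uniformly on the r-disc.
    let R : NNReal := ⟨(n : ℝ) - 1 / 2, by linarith⟩
    let r : NNReal := ⟨(n : ℝ) - 1, by linarith⟩
    have hR : (R : ℝ) = (n : ℝ) - 1 / 2 := rfl
    have hr : (r : ℝ) = (n : ℝ) - 1 := rfl
    have hf := (hc.mono (closedBall_subset_ball (by rw [hR]; linarith))).hasFPowerSeriesOnBall
      (c := 0) (R := R) (by rw [← NNReal.coe_pos, hR]; linarith)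
    have hu := hf.tendstoUniformlyOn (r' := r)
      (by rw [ENNReal.coe_lt_coe, ← NNReal.coe_lt_coe, hR, hr]; linarith)
    obtain ⟨N, hN⟩ := (Metric.tendstoUniformlyOn_iff.1 hu ε hε).exists
    refine ⟨(cauchyPowerSeries c 0 R).partialSum N, ?_, fun z hz => ?_⟩
    · unfold FormalMultilinearSeries.partialSum
      refine Differentiable.fun_sum fun k _ => ?_
      simp only [FormalMultilinearSeries.apply_eq_pow_smul_coeff]
      fun_prop
    · have := hN z (by rwa [hr])
      rw [zero_add, dist_eq_norm] at this
      exact this.le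

/-- Vanishing of the first cohomology of the sheaf of holomorphic functions on `ℂ`, for the cover
by discs with integer radii. -/
theorem exists_differentiableOn_sub_eq {c : ℕ → ℂ → ℂ}
    (hc : ∀ n : ℕ, DifferentiableOn ℂ (c n) (ball 0 n)) :
    ∃ h : ℕ → ℂ → ℂ, (∀ n : ℕ, DifferentiableOn ℂ (h n) (ball 0 n)) ∧
      ∀ n : ℕ, ∀ z ∈ ball (0 : ℂ) n, h (n + 1) z - h n z = c n z := by
  choose p hp hcp using fun n => exists_differentiable_norm_sub_le (hc n)
    (show (0 : ℝ) < (1 / 2) ^ n by positivity)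
  have hbound : ∀ n k : ℕ, ∀ z ∈ ball (0 : ℂ) n,
      ‖c (n + 1 + k) z - p (n + 1 + k) z‖ ≤ (1 / 2 : ℝ) ^ (n + 1 + k) := by
    intro n k z hz
    refine hcp _ z (ball_subset_ball ?_ hz)
    push_cast
    have : (0 : ℝ) ≤ k := k.cast_nonneg
    linarith
  have hsum : ∀ n : ℕ, Summable fun k : ℕ => (1 / 2 : ℝ) ^ (n + 1 + k) := fun n => by
    simp_rw [pow_add _ (n + 1)]
    exact summable_geometric_two.mul_left _
  -- Formally this is -∑_{m ≥ n} c m, made convergent by adding ∑ p m. The term c n stands apart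
  -- because its approximation is controlled only on the disc of radius n - 1.
  refine ⟨fun n z => ∑ m ∈ Finset.range (n + 1), p m z - c n z -
    ∑' k, (c (n + 1 + k) z - p (n + 1 + k) z), fun n => ?_, fun n z hz => ?_⟩
  · refine ((DifferentiableOn.fun_sum fun m _ => (hp m).differentiableOn).sub (hc n)).sub
      (Complex.differentiableOn_tsum_of_summable_norm (hsum n) (fun k => ?_) isOpen_ball
        (hbound n))
    refine ((hc _).mono (ball_subset_ball ?_)).sub (hp _).differentiableOn
    exact_mod_cast by omega
  · have hs : Summable fun k => c (n + 1 + k) z - p (n + 1 + k) z :=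
      Summable.of_norm_bounded (hsum n) fun k => hbound n k z hz
    have h1 : ∑' k, (c (n + 1 + k) z - p (n + 1 + k) z) = (c (n + 1) z - p (n + 1) z) +
        ∑' k, (c (n + 1 + 1 + k) z - p (n + 1 + 1 + k) z) := by
      rw [hs.tsum_eq_zero_add]
      congr 1
      exact tsum_congr fun k => by rw [show n + 1 + (k + 1) = n + 1 + 1 + k by omega]
    beta_reduce
    rw [Finset.sum_range_succ _ (n + 1), h1]
    ring

/-- A nowhere vanishing holomorphic function on a disc has a logarithm. -/
theorem exists_differentiableOn_exp_eq {e : ℂ → ℂ} {r : ℝ}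
    (he : DifferentiableOn ℂ e (ball 0 r)) (h0 : ∀ z ∈ ball (0 : ℂ) r, e z ≠ 0) :
    ∃ c : ℂ → ℂ, DifferentiableOn ℂ c (ball 0 r) ∧
      ∀ z ∈ ball (0 : ℂ) r, Complex.exp (c z) = e z := by
  rcases le_or_gt r 0 with hr | hr
  · exact ⟨0, differentiableOn_const 0, by simp [ball_eq_empty.2 hr]⟩
  have h00 : (0 : ℂ) ∈ ball (0 : ℂ) r := mem_ball_self hr
  -- g is a primitive of e'/e, so e * exp(-g) is constant.
  obtain ⟨g, hg0, hg⟩ := ((he.deriv isOpen_ball).div he h0).isExactOn_ball.with_val_at 0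
    (Complex.log (e 0))
  refine ⟨g, fun z hz => (hg z hz).differentiableAt.differentiableWithinAt, fun z hz => ?_⟩
  have hd : ∀ w ∈ ball (0 : ℂ) r, HasDerivAt (fun w => e w * Complex.exp (-g w)) 0 w := by
    intro w hw
    have h1 := (he.differentiableAt (isOpen_ball.mem_nhds hw)).hasDerivAt
    have h2 := h1.mul (hg w hw).neg.cexp
    refine h2.congr_deriv ?_
    have := h0 w hw
    rw [Pi.div_apply, Pi.neg_apply]
    field_simp
    ring
  have hconst := isOpen_ball.is_const_of_deriv_eq_zero
    (convex_ball (0 : ℂ) r).isPreconnected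
    (fun w hw => (hd w hw).differentiableAt.differentiableWithinAt)
    (fun w hw => (hd w hw).deriv) hz h00
  simp only [hg0, Complex.exp_neg, Complex.exp_log (h0 0 h00), mul_inv_cancel₀ (h0 0 h00)]
    at hconst
  exact ((mul_inv_eq_one₀ (Complex.exp_ne_zero _)).1 hconst).symm

/-- The multiplicative version of `exists_differentiableOn_sub_eq`. -/
theorem exists_differentiableOn_mul_eq {e : ℕ → ℂ → ℂ}
    (he : ∀ n : ℕ, DifferentiableOn ℂ (e n) (ball 0 n))
    (h0 : ∀ n : ℕ, ∀ z ∈ ball (0 : ℂ) n, e n z ≠ 0) :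
    ∃ E : ℕ → ℂ → ℂ, (∀ n : ℕ, DifferentiableOn ℂ (E n) (ball 0 n)) ∧ (∀ n z, E n z ≠ 0) ∧
      ∀ n : ℕ, ∀ z ∈ ball (0 : ℂ) n, e n z * E (n + 1) z = E n z := by
  choose c hc hce using fun n => exists_differentiableOn_exp_eq (he n) (h0 n)
  obtain ⟨h, hh, hhc⟩ := exists_differentiableOn_sub_eq hc
  refine ⟨fun n z => Complex.exp (-h n z), fun n => (hh n).neg.cexp,
    fun n z => Complex.exp_ne_zero _, fun n z hz => ?_⟩
  rw [← hce n z hz, ← Complex.exp_add, ← hhc n z hz]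
  ring_nf

/-- Compatible holomorphic functions on discs glue to an entire function. -/
theorem exists_differentiable_eq_of_compatible {F : ℕ → ℂ → ℂ} {N : ℕ}
    (hF : ∀ n : ℕ, N ≤ n → DifferentiableOn ℂ (F n) (ball 0 n))
    (h : ∀ n : ℕ, N ≤ n → ∀ z ∈ ball (0 : ℂ) n, F (n + 1) z = F n z) :
    ∃ G : entireFunctions, ∀ n : ℕ, N ≤ n → ∀ z ∈ ball (0 : ℂ) n, G.1 z = F n z := by
  have hmono : ∀ n m : ℕ, N ≤ n → n ≤ m → ∀ z ∈ ball (0 : ℂ) n, F m z = F n z := by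
    intro n m hn hnm z hz
    induction m, hnm using Nat.le_induction with
    | base => rfl
    | succ m hm ih =>
      rw [h m (hn.trans hm) z (ball_subset_ball (by exact_mod_cast hm) hz), ih]
  let k : ℂ → ℕ := fun z => N + (⌊‖z‖⌋₊ + 1)
  have hk : ∀ z, z ∈ ball (0 : ℂ) (k z) := fun z => by
    rw [mem_ball_zero_iff]
    refine (Nat.lt_floor_add_one ‖z‖).trans_le ?_
    simp only [k]
    push_cast
    have : (0 : ℝ) ≤ N := N.cast_nonneg
    linarith
  have hG : ∀ n : ℕ, N ≤ n → ∀ z ∈ ball (0 : ℂ) n, F (k z) z = F n z := by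
    intro n hn z hz
    rcases le_total n (k z) with hl | hl
    · exact hmono n _ hn hl z hz
    · exact (hmono _ n (Nat.le_add_right _ _) hl z (hk z)).symm
  refine ⟨⟨fun z => F (k z) z, fun z => ?_⟩, hG⟩
  have hN : N ≤ k z := Nat.le_add_right _ _
  have hz := isOpen_ball.mem_nhds (hk z)
  refine ((hF _ hN).differentiableAt hz).congr_of_eventuallyEq ?_
  filter_upwards [hz] with w hw using hG _ hN w hw

/-! ### Ring-theoretic criteria -/

/-- A ring whose ideals are totally ordered is an MTL-ring. -/
theorem ValuationRing.isMTLRing (R : Type*) [CommRing R] [IsDomain R] [ValuationRing R] :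
    IsMTLRing R := by
  have key : ∀ I J : Ideal R, I ≤ J → idealImp I J = ⊤ := fun I J h =>
    (Ideal.eq_top_iff_one _).2 fun a ha => by rw [one_mul]; exact h ha
  intro I J
  rcases (ValuationRing.iff_ideal_total.1 ‹_›).total I J with h | h
  · rw [key I J h, Submodule.add_eq_sup, top_sup_eq]
  · rw [key J I h, Submodule.add_eq_sup, sup_top_eq]

/-- A BL-domain has no infinite chain of proper divisors. -/
theorem not_isBLRing_of_chain {R : Type*} [CommRing R] [IsDomain R] {q u : ℕ → R}
    (h0 : q 0 ≠ 0) (hq : ∀ n, q n = u n * q (n + 1)) (hu : ∀ n, ¬ IsUnit (u n)) :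
    ¬ IsBLRing R := by
  intro hR
  have hmono : Monotone fun n => Ideal.span {q n} := monotone_nat_of_le_succ fun n => by
    rw [Ideal.span_singleton_le_span_singleton, hq n]
    exact dvd_mul_left _ _
  set I : Ideal R := ⨆ n, Ideal.span {q n}
  set J : Ideal R := Ideal.span {q 0}
  have hle : ∀ n, Ideal.span {q n} ≤ I := le_iSup fun n => Ideal.span {q n}
  have hmem : q 0 ∈ I * idealImp I J := by
    rw [← hR.divisible I J, inf_eq_right.2 (hle 0)]
    exact Ideal.mem_span_singleton_self _
  rw [Ideal.iSup_mul, Submodule.mem_iSup_of_directed _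
    (Monotone.directed_le fun a b h => Ideal.mul_mono_left (hmono h))] at hmem
  obtain ⟨n, hn⟩ := hmem
  obtain ⟨k, hk, hkq⟩ := Ideal.mem_span_singleton_mul.1 hn
  obtain ⟨r, hr⟩ := Ideal.mem_span_singleton.1
    (hk (q (n + 1)) (hle _ (Ideal.mem_span_singleton_self _)))
  -- From q 0 = q n * k and k * q (n+1) = q 0 * r follows q 0 = u n * r * q 0.
  refine hu n (IsUnit.of_mul_eq_one r (mul_right_cancel₀ h0 ?_))
  linear_combination u n * hr * (-1) + hkq - k * hq n

/-! ### Zeros and linear factors of entire functions -/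

namespace entireFunctions

theorem differentiable_coe (f : entireFunctions) : Differentiable ℂ f.1 := f.2

theorem analyticOnNhd_coe (f : entireFunctions) : AnalyticOnNhd ℂ f.1 univ :=
  (differentiable_coe f).differentiableOn.analyticOnNhd isOpen_univ

theorem mul_apply (f g : entireFunctions) (z : ℂ) : (f * g).1 z = f.1 z * g.1 z := rfl

instance : IsDomain entireFunctions :=
  haveI : NoZeroDivisors entireFunctions := ⟨fun {f g} h => by
    have hz : ∀ z ∈ univ, f.1 z * g.1 z = 0 := fun z _ => congrFun (congrArg Subtype.val h) z
    rcases (analyticOnNhd_coe f).eq_zero_or_eq_zero_of_mul_eq_zero (analyticOnNhd_coe g) hz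
      isPreconnected_univ with h | h
    · exact Or.inl (Subtype.ext (funext fun z => h z (mem_univ z)))
    · exact Or.inr (Subtype.ext (funext fun z => h z (mem_univ z)))⟩
  NoZeroDivisors.to_isDomain _

theorem finite_zeros {f : entireFunctions} (hf : f ≠ 0) (r : ℝ) :
    {z ∈ ball (0 : ℂ) r | f.1 z = 0}.Finite := by
  by_contra hinf
  obtain ⟨x, -, hx⟩ := Set.Infinite.exists_accPt_of_subset_isCompact hinf
    (isCompact_closedBall (0 : ℂ) r) fun z hz => ball_subset_closedBall hz.1
  have hfreq : ∃ᶠ z in 𝓝[≠] x, f.1 z = 0 :=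
    (accPt_iff_frequently_nhdsNE.1 hx).mono fun z hz => hz.2
  refine hf (Subtype.ext (funext fun z => ?_))
  exact (analyticOnNhd_coe f).eqOn_zero_of_preconnected_of_frequently_eq_zero isPreconnected_univ
    (mem_univ x) hfreq (mem_univ z)

/-- The entire function with constant value `c`. -/
def const (c : ℂ) : entireFunctions := ⟨fun _ => c, differentiable_const c⟩

/-- The entire function `z ↦ z - a`. -/
def linear (a : ℂ) : entireFunctions := ⟨fun z => z - a, differentiable_id.sub_const a⟩

theorem const_mul_const_inv {c : ℂ} (hc : c ≠ 0) : const c⁻¹ * const c = 1 :=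
  Subtype.ext (funext fun _ => inv_mul_cancel₀ hc)

theorem linear_apply_self (a : ℂ) : (linear a).1 a = 0 := sub_self a

theorem exists_eq_const_add_linear_mul (f : entireFunctions) (a : ℂ) :
    ∃ q, f = const (f.1 a) + linear a * q := by
  have hd : Differentiable ℂ (dslope f.1 a) := differentiableOn_univ.1
    ((Complex.differentiableOn_dslope univ_mem).2 (differentiable_coe f).differentiableOn)
  refine ⟨⟨dslope f.1 a, hd⟩, Subtype.ext (funext fun z => ?_)⟩
  have := sub_smul_dslope f.1 a z
  rw [smul_eq_mul] at this
  change f.1 z = f.1 a + (z - a) * dslope f.1 a z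
  rw [this]
  ring

theorem linear_dvd {f : entireFunctions} {a : ℂ} (h : f.1 a = 0) : linear a ∣ f := by
  obtain ⟨q, hq⟩ := exists_eq_const_add_linear_mul f a
  refine ⟨q, hq.trans ?_⟩
  rw [h]
  exact zero_add _

theorem isCoprime_linear {f : entireFunctions} {a : ℂ} (h : f.1 a ≠ 0) :
    IsCoprime f (linear a) := by
  obtain ⟨q, hq⟩ := exists_eq_const_add_linear_mul f a
  refine ⟨const (f.1 a)⁻¹, -(const (f.1 a)⁻¹ * q), ?_⟩
  linear_combination const (f.1 a)⁻¹ * hq + const_mul_const_inv h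

theorem exists_eq_linear_pow_mul {f : entireFunctions} (hf : f ≠ 0) (a : ℂ) :
    ∃ (k : ℕ) (f' : entireFunctions), f = linear a ^ k * f' ∧ f'.1 a ≠ 0 := by
  obtain ⟨n, hn⟩ : ∃ n : ℕ, analyticOrderAt f.1 a = n := by
    refine (ENat.ne_top_iff_exists.1 fun h => hf ?_).imp fun n hn => hn.symm
    refine Subtype.ext (funext fun z => ?_)
    exact (analyticOnNhd_coe f).eqOn_zero_of_preconnected_of_eventuallyEq_zero isPreconnected_univ
      (mem_univ a) (analyticOrderAt_eq_top.1 h) (mem_univ z)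
  clear hf
  induction n generalizing f with
  | zero =>
    refine ⟨0, f, by rw [pow_zero, one_mul], ?_⟩
    exact ((analyticOnNhd_coe f) a (mem_univ a)).analyticOrderAt_eq_zero.1 (by simpa using hn)
  | succ n ih =>
    have h0 : f.1 a = 0 := by
      by_contra h
      rw [((analyticOnNhd_coe f) a (mem_univ a)).analyticOrderAt_eq_zero.2 h] at hn
      exact absurd hn.symm (by exact_mod_cast n.succ_ne_zero)
    obtain ⟨q, rfl⟩ := linear_dvd h0
    have hlin : analyticOrderAt (linear a).1 a = 1 := by
      rw [← Nat.cast_one, AnalyticAt.analyticOrderAt_eq_natCast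
        (analyticOnNhd_coe (linear a) a (mem_univ a))]
      exact ⟨fun _ => 1, analyticAt_const, one_ne_zero,
        Eventually.of_forall fun z => by simp [linear]⟩
    have hq : analyticOrderAt q.1 a = n := by
      have := analyticOrderAt_mul (analyticOnNhd_coe (linear a) a (mem_univ a))
        ((analyticOnNhd_coe q) a (mem_univ a))
      rw [hlin] at this
      have h2 : (1 : ℕ∞) + analyticOrderAt q.1 a = 1 + n := by
        rw [← this, add_comm 1 (n : ℕ∞)]
        exact_mod_cast hn
      exact (ENat.add_right_injective_of_ne_top ENat.one_ne_top) h2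
    obtain ⟨k, f', hk, hf'⟩ := ih hq
    exact ⟨k + 1, f', by rw [hk, pow_succ]; ring, hf'⟩

/-- k is the smaller of the two vanishing orders; it is finite because f ≠ 0, even when g = 0. -/
theorem exists_eq_linear_pow_mul_of_pair {f : entireFunctions} (hf : f ≠ 0)
    (g : entireFunctions) (a : ℂ) :
    ∃ (k : ℕ) (f' g' : entireFunctions), f = linear a ^ k * f' ∧ g = linear a ^ k * g' ∧
      ¬ (f'.1 a = 0 ∧ g'.1 a = 0) := by
  obtain ⟨k, f', hk, hf'⟩ := exists_eq_linear_pow_mul hf a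
  induction k generalizing f g with
  | zero => exact ⟨0, f', g, hk, by rw [pow_zero, one_mul], fun h => hf' h.1⟩
  | succ k ih =>
    by_cases hg : g.1 a = 0
    · obtain ⟨g₁, rfl⟩ := linear_dvd hg
      have hk' : f = linear a * (linear a ^ k * f') := by rw [hk, pow_succ]; ring
      have h0 : linear a ^ k * f' ≠ 0 := fun h => hf (by rw [hk', h, mul_zero])
      obtain ⟨j, f₂, g₂, hf₂, hg₂, h⟩ := ih h0 g₁ rfl
      exact ⟨j + 1, f₂, g₂, by rw [hk', hf₂, pow_succ]; ring, by rw [hg₂, pow_succ]; ring, h⟩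
    · exact ⟨0, f, g, by rw [pow_zero, one_mul], by rw [pow_zero, one_mul], fun h => hg h.2⟩

/-- The common zeros of two entire functions. -/
def commonZeros (f g : entireFunctions) : Set ℂ := {z | f.1 z = 0 ∧ g.1 z = 0}

theorem commonZeros_subset_mul (d f g : entireFunctions) :
    commonZeros f g ⊆ commonZeros (d * f) (d * g) := fun z hz => by
  simp only [commonZeros, mem_ofPred_eq, mul_apply] at hz ⊢
  rw [hz.1, hz.2, mul_zero]
  exact ⟨rfl, rfl⟩

/-- The common zeros in a disc of two entire functions can be split off. -/
theorem exists_eq_mul_of_mem_ball {f : entireFunctions} (hf : f ≠ 0) (g : entireFunctions)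
    (r : ℝ) :
    ∃ d ∈ Submonoid.closure (linear '' commonZeros f g), ∃ f' g', f = d * f' ∧ g = d * g' ∧
      ∀ z ∈ ball (0 : ℂ) r, z ∉ commonZeros f' g' := by
  -- Splitting off one common zero with its full common multiplicity lowers the number of common
  -- zeros in the disc.
  induction hn : (ball (0 : ℂ) r ∩ commonZeros f g).ncard using Nat.strong_induction_on
    generalizing f g with
  | _ n ih =>
    subst hn
    by_cases hne : ∃ a ∈ ball (0 : ℂ) r, a ∈ commonZeros f g
    · obtain ⟨a, har, ha⟩ := hne
      obtain ⟨k, f₁, g₁, hf₁, hg₁, h₁⟩ := exists_eq_linear_pow_mul_of_pair hf g a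
      have hsub : commonZeros f₁ g₁ ⊆ commonZeros f g := by
        rw [hf₁, hg₁]
        exact commonZeros_subset_mul _ _ _
      have hfin : (ball (0 : ℂ) r ∩ commonZeros f g).Finite :=
        (finite_zeros hf r).subset fun _ hz => And.intro hz.1 hz.2.1
      have hlt : (ball (0 : ℂ) r ∩ commonZeros f₁ g₁).ncard <
          (ball (0 : ℂ) r ∩ commonZeros f g).ncard := by
        refine ncard_lt_ncard ⟨inter_subset_inter_right _ hsub, fun h => h₁ ?_⟩ hfin
        exact (h ⟨har, ha⟩).2
      have hf₁0 : f₁ ≠ 0 := fun h => hf (by rw [hf₁, h, mul_zero])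
      obtain ⟨d, hd, f', g', hf', hg', h⟩ := ih _ hlt hf₁0 g₁ rfl
      refine ⟨linear a ^ k * d, mul_mem (pow_mem (Submonoid.subset_closure (mem_image_of_mem _ ha)) k)
        (Submonoid.closure_mono (image_mono hsub) hd), f', g', ?_, ?_, h⟩
      · rw [mul_assoc, ← hf', hf₁]
      · rw [mul_assoc, ← hg', hg₁]
    · refine ⟨1, one_mem _, f, g, (one_mul f).symm, (one_mul g).symm, fun z hz h => ?_⟩
      exact hne ⟨z, hz, h⟩

theorem mem_of_mem_closure_linear {T : Set ℂ} {d : entireFunctions}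
    (hd : d ∈ Submonoid.closure (linear '' T)) {z : ℂ} (hz : d.1 z = 0) : z ∈ T := by
  induction hd using Submonoid.closure_induction with
  | mem x hx =>
    obtain ⟨a, ha, rfl⟩ := hx
    rwa [sub_eq_zero.1 hz]
  | one => exact absurd hz one_ne_zero
  | mul x y _ _ hx hy => exact (mul_eq_zero.1 hz).elim hx hy

theorem isCoprime_of_mem_closure_linear {T : Set ℂ} {f d : entireFunctions}
    (hd : d ∈ Submonoid.closure (linear '' T)) (hf : ∀ z ∈ T, f.1 z ≠ 0) : IsCoprime f d := by
  induction hd using Submonoid.closure_induction with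
  | mem x hx =>
    obtain ⟨a, ha, rfl⟩ := hx
    exact isCoprime_linear (hf a ha)
  | one => exact isCoprime_one_right
  | mul x y _ _ hx hy => exact hx.mul_right hy

/-! ### Bézout identity and greatest common divisors -/

/-- Entire functions without common zeros generate the unit ideal. -/
theorem isCoprime_of_commonZeros_eq_empty {f g : entireFunctions} (hg : g ≠ 0)
    (h : ∀ z, ¬ (f.1 z = 0 ∧ g.1 z = 0)) : IsCoprime f g := by
  -- Locally g = d * u with u zero-free and d a product of linear factors, so an identity for f and
  -- d becomes one for f and g after division by u.
  have hloc : ∀ n : ℕ, ∃ a b : ℂ → ℂ, DifferentiableOn ℂ a (ball 0 n) ∧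
      DifferentiableOn ℂ b (ball 0 n) ∧
      ∀ z ∈ ball (0 : ℂ) n, a z * f.1 z + b z * g.1 z = 1 := by
    intro n
    obtain ⟨d, hd, u, v, hu, hv, huv⟩ := exists_eq_mul_of_mem_ball hg g n
    obtain ⟨a, b, hab⟩ := isCoprime_of_mem_closure_linear (f := f) hd
      fun z hz h0 => h z ⟨h0, hz.1⟩
    have huv' : u = v := by
      have hd0 : d ≠ 0 := fun h => hg (by rw [hu, h, zero_mul])
      exact mul_left_cancel₀ hd0 (hu.symm.trans hv)
    have hu0 : ∀ z ∈ ball (0 : ℂ) n, u.1 z ≠ 0 := fun z hz h0 => huv z hz ⟨h0, huv' ▸ h0⟩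
    refine ⟨a.1, fun z => b.1 z / u.1 z, (differentiable_coe a).differentiableOn,
      (differentiable_coe b).differentiableOn.div (differentiable_coe u).differentiableOn hu0,
      fun z hz => ?_⟩
    have h1 : a.1 z * f.1 z + b.1 z * d.1 z = 1 := congrFun (congrArg Subtype.val hab) z
    have h2 : g.1 z = d.1 z * u.1 z := congrFun (congrArg Subtype.val hu) z
    have := hu0 z hz
    rw [h2, ← h1]
    field_simp
  choose a b ha hb hab using hloc
  have hsucc : ∀ n : ℕ, ball (0 : ℂ) n ⊆ ball 0 (n + 1 : ℕ) := fun n =>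
    ball_subset_ball (by exact_mod_cast n.le_succ)
  -- The cocycle equals c = a_{n+1} b_n - a_n b_{n+1}. Successive local solutions differ by c * (g,
  -- -f), and the correction k * (-g, f) cancels this.
  obtain ⟨k, hk, hkc⟩ := exists_differentiableOn_sub_eq
    (c := fun n z => (a (n + 1) z - a n z) * b n z - a n z * (b (n + 1) z - b n z))
    (fun n => ((((ha _).mono (hsucc n)).sub (ha n)).mul (hb n)).sub
      ((ha n).mul (((hb _).mono (hsucc n)).sub (hb n))))
  obtain ⟨A, hA⟩ := exists_differentiable_eq_of_compatible (N := 0)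
    (F := fun n z => a n z - k n z * g.1 z)
    (fun n _ => (ha n).sub ((hk n).mul (differentiable_coe g).differentiableOn))
    (fun n _ z hz => by
      have h1 := hab n z hz
      have h2 := hab (n + 1) z (hsucc n hz)
      have h3 := hkc n z hz
      linear_combination (-g.1 z) * h3 + a n z * h2 - a (n + 1) z * h1)
  obtain ⟨B, hB⟩ := exists_differentiable_eq_of_compatible (N := 0)
    (F := fun n z => b n z + k n z * f.1 z)
    (fun n _ => (hb n).add ((hk n).mul (differentiable_coe f).differentiableOn))
    (fun n _ z hz => by
      have h1 := hab n z hz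
      have h2 := hab (n + 1) z (hsucc n hz)
      have h3 := hkc n z hz
      linear_combination f.1 z * h3 + b n z * h2 - b (n + 1) z * h1)
  refine ⟨A, B, Subtype.ext (funext fun z => ?_)⟩
  obtain ⟨n, hn⟩ := exists_nat_gt ‖z‖
  have hz : z ∈ ball (0 : ℂ) n := mem_ball_zero_iff.2 hn
  change A.1 z * f.1 z + B.1 z * g.1 z = 1
  rw [hA n n.zero_le z hz, hB n n.zero_le z hz, ← hab n z hz]
  ring

/-- Two entire functions have a greatest common divisor with coprime cofactors. -/
theorem exists_eq_mul_isCoprime {f g : entireFunctions} (hf : f ≠ 0) (hg : g ≠ 0) :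
    ∃ d f' g', f = d * f' ∧ g = d * g' ∧ IsCoprime f' g' := by
  have step : ∀ (p : {p : entireFunctions × entireFunctions // p.1 ≠ 0}) (r : ℝ),
      ∃ (e : entireFunctions) (p' : {p : entireFunctions × entireFunctions // p.1 ≠ 0}),
        p.1.1 = e * p'.1.1 ∧ p.1.2 = e * p'.1.2 ∧
        (∀ z, e.1 z = 0 → z ∈ commonZeros p.1.1 p.1.2) ∧
        ∀ z ∈ ball (0 : ℂ) r, z ∉ commonZeros p'.1.1 p'.1.2 := by
    rintro ⟨⟨f, g⟩, hf⟩ r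
    obtain ⟨e, he, f', g', hf', hg', h⟩ := exists_eq_mul_of_mem_ball hf g r
    refine ⟨e, ⟨(f', g'), fun h => hf ?_⟩, hf', hg',
      fun z hz => mem_of_mem_closure_linear he hz, h⟩
    exact hf'.trans ((congrArg (e * ·) h).trans (mul_zero e))
  choose e next hnf hng hez hnz using step
  -- Stage n + 1 clears the common zeros in the disc of radius n + 1, so ε n, which vanishes only at
  -- common zeros of stage n, is zero-free on the disc of radius n.
  let s : ℕ → {p : entireFunctions × entireFunctions // p.1 ≠ 0} := fun n =>
    Nat.rec ⟨(f, g), hf⟩ (fun n p => next p (n + 1 : ℕ)) n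
  let ε : ℕ → entireFunctions := fun n => e (s n) (n + 1 : ℕ)
  have hs1 : ∀ n, (s n).1.1 = ε n * (s (n + 1)).1.1 := fun n => hnf _ _
  have hs2 : ∀ n, (s n).1.2 = ε n * (s (n + 1)).1.2 := fun n => hng _ _
  have hsz : ∀ n : ℕ, ∀ z ∈ ball (0 : ℂ) n, z ∉ commonZeros (s n).1.1 (s n).1.2 := by
    intro n z hz
    cases n with
    | zero => simp at hz
    | succ n => exact hnz _ _ z hz
  have hε : ∀ n : ℕ, ∀ z ∈ ball (0 : ℂ) n, (ε n).1 z ≠ 0 := fun n z hz h0 =>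
    hsz n z hz (hez _ _ z h0)
  -- E n stands in for the possibly divergent tail ∏_{k ≥ n} ε k.
  obtain ⟨E, hE, hE0, hEε⟩ := exists_differentiableOn_mul_eq
    (fun n => (differentiable_coe (ε n)).differentiableOn) hε
  have hprod1 : ∀ n, f = (∏ k ∈ Finset.range n, ε k) * (s n).1.1 := fun n => by
    induction n with
    | zero => exact (one_mul _).symm
    | succ n ih => rw [ih, hs1 n, Finset.prod_range_succ, mul_assoc]
  have hprod2 : ∀ n, g = (∏ k ∈ Finset.range n, ε k) * (s n).1.2 := fun n => by
    induction n with
    | zero => exact (one_mul _).symm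
    | succ n ih => rw [ih, hs2 n, Finset.prod_range_succ, mul_assoc]
  obtain ⟨D, hD⟩ := exists_differentiable_eq_of_compatible (N := 0)
    (F := fun n z => (∏ k ∈ Finset.range n, ε k).1 z * E n z)
    (fun n _ => (differentiable_coe _).differentiableOn.mul (hE n))
    (fun n _ z hz => by
      rw [Finset.prod_range_succ, mul_apply, mul_assoc, hEε n z hz])
  have hquot : ∀ t : ℕ → entireFunctions, (∀ n, t n = ε n * t (n + 1)) →
      ∃ G : entireFunctions, ∀ n : ℕ, 0 ≤ n → ∀ z ∈ ball (0 : ℂ) n,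
        G.1 z = (t n).1 z / E n z := by
    intro t ht
    refine exists_differentiable_eq_of_compatible (N := 0) (F := fun n z => (t n).1 z / E n z)
      (fun n _ => (differentiable_coe _).differentiableOn.div (hE n) fun z _ => hE0 n z)
      (fun n _ z hz => ?_)
    rw [ht n, mul_apply, ← hEε n z hz, mul_div_mul_left _ _ (hε n z hz)]
  obtain ⟨f', hf'⟩ := hquot (fun n => (s n).1.1) hs1
  obtain ⟨g', hg'⟩ := hquot (fun n => (s n).1.2) hs2
  have hball : ∀ z : ℂ, ∃ n : ℕ, z ∈ ball (0 : ℂ) n := fun z =>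
    (exists_nat_gt ‖z‖).imp fun n hn => mem_ball_zero_iff.2 hn
  have hg'' : g = D * g' := by
    refine Subtype.ext (funext fun z => ?_)
    obtain ⟨n, hz⟩ := hball z
    rw [mul_apply, hD n n.zero_le z hz, hg' n n.zero_le z hz, mul_assoc,
      mul_div_cancel₀ _ (hE0 n z), ← mul_apply, ← hprod2 n]
  refine ⟨D, f', g', ?_, hg'', ?_⟩
  · refine Subtype.ext (funext fun z => ?_)
    obtain ⟨n, hz⟩ := hball z
    rw [mul_apply, hD n n.zero_le z hz, hf' n n.zero_le z hz, mul_assoc,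
      mul_div_cancel₀ _ (hE0 n z), ← mul_apply, ← hprod1 n]
  · refine isCoprime_of_commonZeros_eq_empty (fun h => hg (by rw [hg'', h, mul_zero]))
      fun z hz => ?_
    obtain ⟨n, hzn⟩ := hball z
    rw [hf' n n.zero_le z hzn, hg' n n.zero_le z hzn, div_eq_zero_iff, div_eq_zero_iff,
      or_iff_left (hE0 n z), or_iff_left (hE0 n z)] at hz
    exact hsz n z hzn hz

/-! ### Ideals that are not finitely generated, and localizations -/

theorem linear_notMem {M : Ideal entireFunctions} (hM : M ≠ ⊤) (hfg : ¬ M.FG) (a : ℂ) :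
    linear a ∉ M := by
  intro ha
  refine hfg ⟨{linear a}, le_antisymm ?_ fun g hg => ?_⟩
  · rw [Finset.coe_singleton]
    exact (Ideal.span_singleton_le_iff_mem M).2 ha
  rw [Finset.coe_singleton]
  refine Ideal.mem_span_singleton.2 (linear_dvd ?_)
  by_contra h0
  obtain ⟨q, hq⟩ := exists_eq_const_add_linear_mul g a
  refine hM ((Ideal.eq_top_iff_one M).2 ?_)
  rw [← const_mul_const_inv h0, eq_sub_of_add_eq hq.symm]
  exact M.mul_mem_left _ (M.sub_mem hg (M.mul_mem_right _ ha))

/-- A prime ideal that is not finitely generated contains an infinite chain of proper divisors. -/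
theorem exists_chain {M : Ideal entireFunctions} [hp : M.IsPrime] (hfg : ¬ M.FG) :
    ∃ q u : ℕ → entireFunctions, q 0 ≠ 0 ∧ (∀ n, q n = u n * q (n + 1)) ∧ ∀ n, u n ∈ M := by
  obtain ⟨f, hfM, hf⟩ := Submodule.exists_mem_ne_zero_of_ne_bot
    (fun h : M = ⊥ => hfg (h ▸ Submodule.fg_bot))
  -- Radius n + 1 instead of n makes u 0 nonzero at the origin, whence q 0 ≠ 0. The removed factor d
  -- is a product of linear factors, none in M, so primality puts u in M.
  have hu : ∀ n : ℕ, ∃ u ∈ M, ∀ z ∈ ball (0 : ℂ) (n + 1), u.1 z ≠ 0 := by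
    intro n
    obtain ⟨d, hd, u, v, hu, hv, huv⟩ := exists_eq_mul_of_mem_ball hf f (n + 1)
    have hd0 : d ≠ 0 := fun h => hf (by rw [hu, h, zero_mul])
    have huv' : u = v := mul_left_cancel₀ hd0 (hu.symm.trans hv)
    refine ⟨u, ?_, fun z hz h0 => huv z hz ⟨h0, huv' ▸ h0⟩⟩
    refine (hp.mem_or_mem (hu ▸ hfM)).resolve_left ?_
    have hle : Submonoid.closure (linear '' commonZeros f f) ≤ M.primeCompl :=
      Submonoid.closure_le.2 (by
        rintro _ ⟨a, -, rfl⟩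
        exact linear_notMem hp.ne_top hfg a)
    exact hle hd
  choose u huM hu0 using hu
  obtain ⟨E, hE, hE0, hEu⟩ := exists_differentiableOn_mul_eq
    (fun n => (differentiable_coe (u n)).differentiableOn)
    (fun n z hz => hu0 n z (ball_subset_ball (by linarith) hz))
  -- q N is the corrected tail product of the u k with k ≥ N.
  choose q hq using fun N => exists_differentiable_eq_of_compatible (N := N)
    (F := fun n z => (∏ k ∈ Finset.Ico N n, u k).1 z * E n z)
    (fun n _ => (differentiable_coe _).differentiableOn.mul (hE n))
    (fun n hn z hz => by
      rw [Finset.prod_Ico_succ_top hn, mul_apply, mul_assoc, hEu n z hz])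
  refine ⟨q, u, fun h => ?_, fun N => Subtype.ext (funext fun z => ?_), huM⟩
  · have h1 := hq 0 1 zero_le_one 0 (mem_ball_self (by norm_num))
    rw [h] at h1
    simp only [Nat.Ico_succ_singleton, Finset.prod_singleton] at h1
    exact mul_ne_zero (hu0 0 0 (mem_ball_self (by norm_num))) (hE0 1 0) h1.symm
  · obtain ⟨n, hn⟩ := exists_nat_gt (max ‖z‖ N)
    have hz : z ∈ ball (0 : ℂ) n := mem_ball_zero_iff.2 ((le_max_left _ _).trans_lt hn)
    have hNn : N < n := by exact_mod_cast (le_max_right _ _).trans_lt hn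
    rw [mul_apply, hq N n hNn.le z hz, hq (N + 1) n hNn z hz,
      Finset.prod_eq_prod_Ico_succ_bot hNn, mul_apply, mul_assoc]

/-- After cancelling the common divisor, the coprime cofactors cannot both lie in M, and one outside
M is a unit. Denominators are units, so numerators suffice. -/
instance (M : Ideal entireFunctions) [M.IsPrime] : ValuationRing (Localization.AtPrime M) := by
  have key : ∀ f g : entireFunctions,
      algebraMap _ (Localization.AtPrime M) f ∣ algebraMap _ (Localization.AtPrime M) g ∨
      algebraMap _ (Localization.AtPrime M) g ∣ algebraMap _ (Localization.AtPrime M) f := by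
    intro f g
    by_cases hf : f = 0
    · exact Or.inr (by rw [hf, map_zero]; exact dvd_zero _)
    by_cases hg : g = 0
    · exact Or.inl (by rw [hg, map_zero]; exact dvd_zero _)
    obtain ⟨d, f', g', rfl, rfl, a, b, hab⟩ := exists_eq_mul_isCoprime hf hg
    have hunit : ∀ h : entireFunctions, h ∉ M → ∀ x : Localization.AtPrime M,
        algebraMap _ (Localization.AtPrime M) h ∣ x := fun h hh x =>
      (IsLocalization.map_units (Localization.AtPrime M)
        (⟨h, hh⟩ : M.primeCompl)).dvd
    simp only [map_mul]
    by_cases hf' : f' ∈ M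
    · refine Or.inr (mul_dvd_mul_left _ (hunit g' (fun hg' => ?_) _))
      refine (Ideal.IsPrime.ne_top ‹_›) ((Ideal.eq_top_iff_one M).2 (hab ▸ ?_))
      exact M.add_mem (M.mul_mem_left _ hf') (M.mul_mem_left _ hg')
    · exact Or.inl (mul_dvd_mul_left _ (hunit f' hf' _))
  refine ValuationRing.iff_dvd_total.2 ⟨fun x y => ?_⟩
  obtain ⟨f, s, rfl⟩ := IsLocalization.exists_mk'_eq M.primeCompl x
  obtain ⟨g, t, rfl⟩ := IsLocalization.exists_mk'_eq M.primeCompl y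
  have hassoc : ∀ (f : entireFunctions) (s : M.primeCompl),
      Associated (IsLocalization.mk' (Localization.AtPrime M) f s) (algebraMap _ _ f) :=
    fun f s => ⟨(IsLocalization.map_units (Localization.AtPrime M) s).unit,
      IsLocalization.mk'_spec _ f s⟩
  rw [(hassoc f s).dvd_iff_dvd_left, (hassoc g t).dvd_iff_dvd_right,
    (hassoc g t).dvd_iff_dvd_left, (hassoc f s).dvd_iff_dvd_right]
  exact key f g

end entireFunctions

theorem mainTheorem7 (M : Ideal entireFunctions) [M.IsMaximal] (hM : ¬ M.FG) :
    IsMTLRing (Localization.AtPrime M) ∧ ¬ IsBLRing (Localization.AtPrime M) := by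
  refine ⟨ValuationRing.isMTLRing _, ?_⟩
  obtain ⟨q, u, h0, hq, hu⟩ := entireFunctions.exists_chain hM
  refine not_isBLRing_of_chain (q := fun n => algebraMap _ _ (q n))
    (u := fun n => algebraMap _ _ (u n)) ?_ (fun n => ?_) fun n h => ?_
  · exact (map_ne_zero_iff _ (IsLocalization.injective (Localization.AtPrime M)
      M.primeCompl_le_nonZeroDivisors)).2 h0
  · rw [hq n, map_mul]
  · exact (IsLocalization.AtPrime.isUnit_to_map_iff _ M (u n)).1 h (hu n)
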